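/- Let $H$ be a complex Hilbert space with scalar product $(\cdot,\cdot)$, linear in the first argument. For a linear operator $S$ with domain $\operatorname{dom} S$ let $W(S)=\{(Su,u):u\in\operatorname{dom}S,\ \|u\|=1\}$. Call $S$ *accretive* if $\operatorname{Re}z\ge 0$ for all $z\in W(S)$; *m-accretive* if it is accretive and densely defined and $\operatorname{ran}(S-\lambda I)$ is the whole space for some $\lambda\in\mathbb C$ with $\operatorname{Re}\lambda<0$; *sectorial* if $W(S)\subset\{z\in\mathbb C:|\arg z|\le\alpha\}$ (a closed sector with vertex $0$, which belongs to it) for some $\alpha\in[0,\pi/2)$; and *m-sectorial* if it is sectorial and m-accretive. Let $A$ be an unbounded m-sectorial operator in $H$, let $B$ be a bounded selfadjoint operator on $H$, and let $T:=A+\mathrm iB$ with $\operatorname{dom}T=\operatorname{dom}A$. Then $$\operatorname{dom}T\cap\operatorname{dom}T^*=\operatorname{dom}A\cap\operatorname{dom}A^*,$$ and the following hold. i) If $\operatorname{ran}A=H$, then $\ker A=\{0\}$ and $T$ is m-sectorial. ii) If $\ker A=\{0\}$ and $$\sup_{u\in\operatorname{dom}A\setminus\{0\}}\frac{|(Bu,u)|}{\operatorname{Re}(Au,u)}=\infty,$$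 then $\operatorname{ran}A\neq H$; the operator $T$ is m-accretive but not sectorial; and the same holds for $T^*$. Moreover, the operators in $H\oplus H$ given by $$\widehat T=\begin{bmatrix}A+\mathrm iB&0\\0&A^*-\mathrm iB\end{bmatrix},\quad \operatorname{dom}\widehat T=\operatorname{dom}A\oplus\operatorname{dom}A^*,\qquad \widetilde T=\begin{bmatrix}A&\mathrm iB\\ \mathrm iB&A\end{bmatrix},\quad \operatorname{dom}\widetilde T=\operatorname{dom}A\oplus\operatorname{dom}A,$$ are m-accretive and satisfy $$\operatorname{dom}\widehat T\cap\operatorname{dom}\widehat T^*=(\operatorname{dom}A\cap\operatorname{dom}A^*)\oplus(\operatorname{dom}A\cap\operatorname{dom}A^*)=\operatorname{dom}\widetilde T\cap\operatorname{dom}\widetilde T^*,$$ and neither $W(\widehat T)$ nor $W(\widetilde T)$ is contained in a sector with vertex $0$ and opening angle $<\pi$ in the closed right half-plane, that is, in a set $\{0\}\cup\{z\neq0:\theta_1\le\arg z\le\theta_2\}$ with $-\pi/2\le\theta_1\le\theta_2\le\pi/2$ and $\theta_2-\theta_1<\pi$. -/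

import Mathlib

open scoped LinearPMap

noncomputable section

/-- The closed sector with vertex `0` bounded by the rays of angles `θ₁` and `θ₂`, where
`-π < θ₁ ≤ θ₂ ≤ π`; its opening angle is `θ₂ - θ₁`. -/
def closedSector (θ₁ θ₂ : ℝ) : Set ℂ :=
  {z | z = 0 ∨ (θ₁ ≤ Complex.arg z ∧ Complex.arg z ≤ θ₂)}

namespace LinearPMap

variable {H : Type*} [NormedAddCommGroup H] [InnerProductSpace ℂ H]

/-- The numerical range `W(T) = {(Tu,u) : u ∈ dom T, ‖u‖ = 1}`. The scalar product `(x,y)` that is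
linear in its first argument is `inner ℂ y x`. -/
def numericalRange (T : H →ₗ.[ℂ] H) : Set ℂ :=
  {z | ∃ u : T.domain, ‖(u : H)‖ = 1 ∧ inner ℂ (u : H) (T u) = z}

/-- `T` is accretive: its numerical range lies in the closed right half-plane. -/
def IsAccretive (T : H →ₗ.[ℂ] H) : Prop :=
  T.numericalRange ⊆ {z : ℂ | 0 ≤ z.re}

/-- `T` is m-accretive: it is accretive and densely defined, and `T - λ` maps `dom T` onto `H` for
some `λ` with `Re λ < 0`. -/
def IsMAccretive (T : H →ₗ.[ℂ] H) : Prop :=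
  T.IsAccretive ∧ Dense (T.domain : Set H) ∧
    ∃ l : ℂ, l.re < 0 ∧ ∀ y : H, ∃ u : T.domain, T u - l • (u : H) = y

/-- `T` is sectorial (with vertex `0`): for some `α ∈ [0, π/2)` its numerical range lies in the
sector `{z | |arg z| ≤ α}`. -/
def IsSectorial (T : H →ₗ.[ℂ] H) : Prop :=
  ∃ α : ℝ, 0 ≤ α ∧ α < Real.pi / 2 ∧ T.numericalRange ⊆ closedSector (-α) α

/-- `T` is m-sectorial: it is sectorial and m-accretive. -/
def IsMSectorial (T : H →ₗ.[ℂ] H) : Prop :=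
  T.IsSectorial ∧ T.IsMAccretive

/-- `T` is bounded on its domain. -/
def IsBoundedOperator (T : H →ₗ.[ℂ] H) : Prop :=
  ∃ C : ℝ, ∀ u : T.domain, ‖T u‖ ≤ C * ‖(u : H)‖

/-- The operator `T + S` with domain `dom T`, for an everywhere defined bounded `S`. -/
def addBounded (T : H →ₗ.[ℂ] H) (S : H →L[ℂ] H) : H →ₗ.[ℂ] H :=
  (S : H →ₗ[ℂ] H) +ᵥ T

/-- The subspace `p ⊕ q` of the Hilbert space `H ⊕ H`. -/
def directSum (p q : Submodule ℂ H) : Submodule ℂ (WithLp 2 (H × H)) :=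
  (p.prod q).comap (WithLp.linearEquiv 2 ℂ (H × H)).toLinearMap

/-- The operator matrix `[P, X; Y, Q]` in `H ⊕ H` with domain `dom P ⊕ dom Q`, for bounded
everywhere defined `X` and `Y`. -/
def blockMatrix (P : H →ₗ.[ℂ] H) (X Y : H →L[ℂ] H) (Q : H →ₗ.[ℂ] H) :
    WithLp 2 (H × H) →ₗ.[ℂ] WithLp 2 (H × H) where
  domain := directSum P.domain Q.domain
  toFun :=
    { toFun := fun w => WithLp.toLp 2
        (P ⟨w.1.fst, w.2.1⟩ + X w.1.snd, Y w.1.fst + Q ⟨w.1.snd, w.2.2⟩)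
      map_add' := fun v w => by
        have h₁ : P ⟨(v + w).1.fst, (v + w).2.1⟩ = P ⟨v.1.fst, v.2.1⟩ + P ⟨w.1.fst, w.2.1⟩ :=
          P.map_add ⟨v.1.fst, v.2.1⟩ ⟨w.1.fst, w.2.1⟩
        have h₂ : Q ⟨(v + w).1.snd, (v + w).2.2⟩ = Q ⟨v.1.snd, v.2.2⟩ + Q ⟨w.1.snd, w.2.2⟩ :=
          Q.map_add ⟨v.1.snd, v.2.2⟩ ⟨w.1.snd, w.2.2⟩
        rw [h₁, h₂, ← WithLp.toLp_add]
        simp only [Submodule.coe_add, WithLp.add_fst, WithLp.add_snd, _root_.map_add, Prod.mk_add_mk]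
        congr 2 <;> abel
      map_smul' := fun c w => by
        have h₁ : P ⟨(c • w).1.fst, (c • w).2.1⟩ = c • P ⟨w.1.fst, w.2.1⟩ :=
          P.map_smul c ⟨w.1.fst, w.2.1⟩
        have h₂ : Q ⟨(c • w).1.snd, (c • w).2.2⟩ = c • Q ⟨w.1.snd, w.2.2⟩ :=
          Q.map_smul c ⟨w.1.snd, w.2.2⟩
        rw [h₁, h₂, RingHom.id_apply, ← WithLp.toLp_smul]
        simp only [Submodule.coe_smul, WithLp.smul_fst, WithLp.smul_snd, _root_.map_smul, Prod.smul_mk,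
          smul_add] }

/-- `A + iB`, with domain `dom A`. -/
def addI (A : H →ₗ.[ℂ] H) (B : H →L[ℂ] H) : H →ₗ.[ℂ] H :=
  A.addBounded (Complex.I • B)

/-- The operator matrix `[A + iB, 0; 0, A* - iB]` with domain `dom A ⊕ dom A*`. -/
def hatOperator [CompleteSpace H] (A : H →ₗ.[ℂ] H) (B : H →L[ℂ] H) :
    WithLp 2 (H × H) →ₗ.[ℂ] WithLp 2 (H × H) :=
  blockMatrix (A.addI B) 0 0 (A†.addBounded (-(Complex.I • B)))

/-- The operator matrix `[A, iB; iB, A]` with domain `dom A ⊕ dom A`. -/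
def tildeOperator (A : H →ₗ.[ℂ] H) (B : H →L[ℂ] H) :
    WithLp 2 (H × H) →ₗ.[ℂ] WithLp 2 (H × H) :=
  blockMatrix A (Complex.I • B) (Complex.I • B) A

end LinearPMap

end

open scoped ComplexConjugate LinearPMap

namespace LinearPMap

variable {H : Type*} [NormedAddCommGroup H] [InnerProductSpace ℂ H]

/-! Sectoriality means that the form lies in the half-planes `Re ((k ∓ i) z) ≥ 0`, that is `|Im| ≤ k
Re`, besides being accretive. Since `B` is selfadjoint, `iB` changes only the imaginary part of the
form of `A`, so `T` is m-accretive (`IsMAccretive.addBounded`), and it is sectorial exactly when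
`|(Bu,u)|` is bounded by a multiple of `Re (Au,u)`.

If `A` is onto, `A⁻¹` exists and is bounded, and a Cauchy–Schwarz estimate (`two_mul_norm_sq_le`)
turns this into `‖u‖² ≤ C Re (Au,u)`; boundedness of `B` then gives sectoriality. If the supremum is
infinite, `T` cannot be sectorial, hence `A` is not onto.

For m-accretive `T` the adjoint is m-accretive, its form lies in the conjugate half-planes, and `T††
= T`. So a one-sided bound on the block diagonal operator of `T` and `T†` is a two-sided bound on
`T`. For the other matrix, the vectors `(u,u)` and `(u,-u)` give both signs of `i(Bu,u)`. A sector
of opening less than `π` always yields such a one-sided bound, which contradicts the infinite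
supremum. -/

/-! ### Sectors and half-planes -/

/-- The numerical range of `T`, multiplied by `c`, lies in the closed right half-plane. -/
def FormNonneg (T : H →ₗ.[ℂ] H) (c : ℂ) : Prop :=
  ∀ u : T.domain, 0 ≤ (c * inner ℂ (u : H) (T u)).re

theorem formNonneg_iff_numericalRange {T : H →ₗ.[ℂ] H} {c : ℂ} :
    T.FormNonneg c ↔ ∀ z ∈ T.numericalRange, 0 ≤ (c * z).re := by
  constructor
  · rintro h z ⟨u, -, rfl⟩
    exact h u
  · intro h u
    by_cases hu : (u : H) = 0
    · simp [hu]
    · have hn : ‖(u : H)‖ ≠ 0 := norm_ne_zero_iff.mpr hu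
      have h1 := h _ ⟨((‖(u : H)‖⁻¹ : ℝ) : ℂ) • u, by
        simp [norm_smul, hn], rfl⟩
      rw [LinearPMap.map_smul, Submodule.coe_smul, inner_smul_left, inner_smul_right,
        Complex.conj_ofReal] at h1
      have h2 : c * (((‖(u : H)‖⁻¹ : ℝ) : ℂ) * (((‖(u : H)‖⁻¹ : ℝ) : ℂ) *
          inner ℂ (u : H) (T u))) =
          ((‖(u : H)‖⁻¹ * ‖(u : H)‖⁻¹ : ℝ) : ℂ) * (c * inner ℂ (u : H) (T u)) := by
        push_cast; ring
      rw [h2, Complex.re_ofReal_mul] at h1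
      have : 0 < ‖(u : H)‖⁻¹ * ‖(u : H)‖⁻¹ := by positivity
      exact nonneg_of_mul_nonneg_right h1 this

theorem isAccretive_iff_formNonneg {T : H →ₗ.[ℂ] H} : T.IsAccretive ↔ T.FormNonneg 1 := by
  rw [formNonneg_iff_numericalRange]
  simp only [one_mul]
  rfl

theorem isAccretive_iff {T : H →ₗ.[ℂ] H} :
    T.IsAccretive ↔ ∀ u : T.domain, 0 ≤ (inner ℂ (u : H) (T u)).re := by
  simp only [isAccretive_iff_formNonneg, FormNonneg, one_mul]

theorem cos_mul_im_ge_of_mem_closedSector {θ₁ θ₂ : ℝ} {z : ℂ} (h₁ : -(Real.pi / 2) ≤ θ₁)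
    (h₂ : θ₂ ≤ Real.pi / 2) (hz : z ∈ closedSector θ₁ θ₂) :
    0 ≤ z.re ∧ Real.sin θ₁ * z.re ≤ Real.cos θ₁ * z.im ∧
      Real.cos θ₂ * z.im ≤ Real.sin θ₂ * z.re := by
  rcases hz with rfl | ⟨ha, hb⟩
  · simp
  have hre : 0 ≤ z.re := by
    rw [← Complex.abs_arg_le_pi_div_two_iff, abs_le]
    constructor <;> linarith
  have hs : 0 ≤ Real.sin (z.arg - θ₁) :=
    Real.sin_nonneg_of_nonneg_of_le_pi (by linarith) (by linarith)
  have ht : 0 ≤ Real.sin (θ₂ - z.arg) :=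
    Real.sin_nonneg_of_nonneg_of_le_pi (by linarith) (by linarith)
  rw [Real.sin_sub] at hs ht
  have e1 := Complex.norm_mul_cos_arg z
  have e2 := Complex.norm_mul_sin_arg z
  refine ⟨hre, ?_, ?_⟩
  · have := mul_nonneg (norm_nonneg z) hs
    rw [← e1, ← e2]
    linarith
  · have := mul_nonneg (norm_nonneg z) ht
    rw [← e1, ← e2]
    linarith

/-- The bounding ray gives the slope `tan θ₁`; since `sin θ₁ ≥ -1`, the cruder constant `1 / cos θ₁`
works and is nonnegative. At `θ₁ = π/2` the sector collapses to the positive imaginary axis, and the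
inverse of `0` is `0`. -/
theorem im_ge_of_mem_closedSector {θ₁ θ₂ : ℝ} {z : ℂ} (h₁ : -(Real.pi / 2) < θ₁)
    (h₁' : θ₁ ≤ Real.pi / 2)
    (h₂ : θ₂ ≤ Real.pi / 2) (hz : z ∈ closedSector θ₁ θ₂) :
    -((Real.cos θ₁)⁻¹ * z.re) ≤ z.im := by
  obtain ⟨hre, h, -⟩ := cos_mul_im_ge_of_mem_closedSector h₁.le h₂ hz
  rcases h₁'.eq_or_lt with rfl | h₁'
  · rcases hz with rfl | ⟨ha, hb⟩
    · simp
    · have : z.arg = Real.pi / 2 := le_antisymm (hb.trans h₂) ha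
      rw [Complex.arg_eq_pi_div_two_iff] at this
      simp [this.1, this.2.le]
  have hc : 0 < Real.cos θ₁ := Real.cos_pos_of_mem_Ioo ⟨h₁, h₁'⟩
  have hs := Real.neg_one_le_sin θ₁
  rw [neg_le, inv_mul_eq_div, le_div_iff₀ hc]
  nlinarith

theorem im_le_of_mem_closedSector {θ₁ θ₂ : ℝ} {z : ℂ} (h₁ : -(Real.pi / 2) ≤ θ₁)
    (h₂ : θ₂ < Real.pi / 2) (h₂' : -(Real.pi / 2) ≤ θ₂) (hz : z ∈ closedSector θ₁ θ₂) :
    z.im ≤ (Real.cos θ₂)⁻¹ * z.re := by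
  obtain ⟨hre, -, h⟩ := cos_mul_im_ge_of_mem_closedSector h₁ h₂.le hz
  rcases h₂'.eq_or_lt with rfl | h₂'
  · rcases hz with rfl | ⟨ha, hb⟩
    · simp
    · have : z.arg = -(Real.pi / 2) := le_antisymm hb (h₁.trans ha)
      rw [Complex.arg_eq_neg_pi_div_two_iff] at this
      simp [this.1, this.2.le]
  have hc : 0 < Real.cos θ₂ := Real.cos_pos_of_mem_Ioo ⟨h₂', h₂⟩
  have hs := Real.sin_le_one θ₂
  rw [inv_mul_eq_div, le_div_iff₀ hc]
  nlinarith

theorem mem_closedSector_arctan {k : ℝ} {z : ℂ} (hre : 0 ≤ z.re) (him : |z.im| ≤ k * z.re) :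
    z ∈ closedSector (-Real.arctan k) (Real.arctan k) := by
  rcases hre.eq_or_lt with h0 | h0
  · left
    rw [← h0, mul_zero] at him
    exact Complex.ext h0.symm (abs_nonpos_iff.mp him)
  · right
    have ha : |z.arg| < Real.pi / 2 := Complex.abs_arg_lt_pi_div_two_iff.mpr (Or.inl h0)
    have : z.arg = Real.arctan (z.im / z.re) := by
      rw [← Complex.tan_arg, Real.arctan_tan (abs_lt.mp ha).1 (abs_lt.mp ha).2]
    rw [this, ← Real.arctan_neg, Real.arctan_le_arctan_iff, Real.arctan_le_arctan_iff,
      div_le_iff₀ h0, le_div_iff₀ h0]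
    have := abs_le.mp him
    constructor <;> linarith

theorem re_ofReal_sub_I_mul (k : ℝ) (z : ℂ) :
    (((k : ℂ) - Complex.I) * z).re = k * z.re + z.im := by
  simp [Complex.mul_re]

theorem re_ofReal_add_I_mul (k : ℝ) (z : ℂ) :
    (((k : ℂ) + Complex.I) * z).re = k * z.re - z.im := by
  simp [Complex.mul_re]

/-- Sectoriality as a bound of the imaginary part of the form by its real part. -/
theorem isSectorial_iff {T : H →ₗ.[ℂ] H} :
    T.IsSectorial ↔ T.IsAccretive ∧
      ∃ k : ℝ, 0 ≤ k ∧ T.FormNonneg (k - Complex.I) ∧ T.FormNonneg (k + Complex.I) := by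
  constructor
  · rintro ⟨α, h0, h1, h⟩
    refine ⟨fun z hz => (cos_mul_im_ge_of_mem_closedSector (by linarith) h1.le (h hz)).1,
      (Real.cos α)⁻¹, inv_nonneg.mpr (Real.cos_pos_of_mem_Ioo ⟨by linarith, h1⟩).le, ?_, ?_⟩
    · rw [formNonneg_iff_numericalRange]
      intro z hz
      have := im_ge_of_mem_closedSector (by linarith) (by linarith) h1.le (h hz)
      rw [Real.cos_neg] at this
      rw [re_ofReal_sub_I_mul]
      linarith
    · rw [formNonneg_iff_numericalRange]
      intro z hz
      have := im_le_of_mem_closedSector (by linarith) h1 (by linarith) (h hz)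
      rw [re_ofReal_add_I_mul]
      linarith
  · rintro ⟨ha, k, hk, h1, h2⟩
    rw [formNonneg_iff_numericalRange] at h1 h2
    refine ⟨Real.arctan k, Real.arctan_nonneg.mpr hk, Real.arctan_lt_pi_div_two k,
      fun z hz => mem_closedSector_arctan (ha hz) (abs_le.mpr ?_)⟩
    have h3 := h1 z hz
    have h4 := h2 z hz
    rw [re_ofReal_sub_I_mul] at h3
    rw [re_ofReal_add_I_mul] at h4
    constructor <;> linarith

theorem IsSectorial.exists_abs_im_le {T : H →ₗ.[ℂ] H} (hT : T.IsSectorial) :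
    ∃ k : ℝ, 0 ≤ k ∧ ∀ u : T.domain,
      |(inner ℂ (u : H) (T u)).im| ≤ k * (inner ℂ (u : H) (T u)).re := by
  obtain ⟨-, k, hk, h1, h2⟩ := isSectorial_iff.mp hT
  refine ⟨k, hk, fun u => abs_le.mpr ?_⟩
  have h3 := h1 u
  have h4 := h2 u
  rw [re_ofReal_sub_I_mul] at h3
  rw [re_ofReal_add_I_mul] at h4
  constructor <;> linarith

theorem IsSectorial.isAccretive {T : H →ₗ.[ℂ] H} (hT : T.IsSectorial) : T.IsAccretive :=
  (isSectorial_iff.mp hT).1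

@[simp] theorem addBounded_domain (T : H →ₗ.[ℂ] H) (K : H →L[ℂ] H) :
    (T.addBounded K).domain = T.domain := rfl

theorem IsAccretive.addBounded {T : H →ₗ.[ℂ] H} (hT : T.IsAccretive) {K : H →L[ℂ] H}
    (hK : ∀ x : H, 0 ≤ (inner ℂ x (K x)).re) : (T.addBounded K).IsAccretive := by
  rw [isAccretive_iff] at hT ⊢
  intro u
  rw [show (T.addBounded K) u = K u + T u from rfl, inner_add_right, Complex.add_re]
  exact add_nonneg (hK _) (hT u)

/-! ### Resolvents and bounded accretive perturbations -/

theorem re_inner_smul_self (l : ℂ) (x : H) : (inner ℂ x (l • x)).re = l.re * ‖x‖ ^ 2 := by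
  have : inner ℂ x x = ((‖x‖ ^ 2 : ℝ) : ℂ) := by
    rw [inner_self_eq_norm_sq_to_K]
    norm_cast
  rw [inner_smul_right, this, Complex.re_mul_ofReal]

theorem IsAccretive.norm_le {T : H →ₗ.[ℂ] H} (hT : T.IsAccretive) (l : ℂ) (u : T.domain) :
    -l.re * ‖(u : H)‖ ≤ ‖T u - l • (u : H)‖ := by
  by_cases hu : (u : H) = 0
  · simp [hu]
  have hn : 0 < ‖(u : H)‖ := norm_pos_iff.mpr hu
  have h1 : (inner ℂ (u : H) (T u - l • (u : H))).re =
      (inner ℂ (u : H) (T u)).re - l.re * ‖(u : H)‖ ^ 2 := by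
    rw [inner_sub_right, Complex.sub_re, re_inner_smul_self]
  have h2 := (Complex.re_le_norm _).trans (norm_inner_le_norm (𝕜 := ℂ) (u : H) (T u - l • (u : H)))
  have h3 := isAccretive_iff.mp hT u
  rw [h1] at h2
  have : -l.re * ‖(u : H)‖ * ‖(u : H)‖ ≤ ‖T u - l • (u : H)‖ * ‖(u : H)‖ := by nlinarith
  exact le_of_mul_le_mul_right this hn

/-- The resolvent of an accretive operator at a point of the open left half-plane at which
the range is the whole space. -/
theorem IsAccretive.exists_resolvent {T : H →ₗ.[ℂ] H} (hT : T.IsAccretive) {l : ℂ}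
    (hl : l.re < 0) (hsurj : ∀ y : H, ∃ u : T.domain, T u - l • (u : H) = y) :
    ∃ R : H →L[ℂ] H, ‖R‖ ≤ (-l.re)⁻¹ ∧
      (∀ y, ∃ u : T.domain, (u : H) = R y ∧ T u - l • (u : H) = y) ∧
      ∀ u : T.domain, R (T u - l • (u : H)) = u := by
  have hl' : 0 < -l.re := by linarith
  let L : T.domain →ₗ[ℂ] H := T.toFun - l • T.domain.subtype
  have hL : ∀ u : T.domain, L u = T u - l • (u : H) := fun u => rfl
  have hinj : Function.Injective L := by
    rw [injective_iff_map_eq_zero]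
    intro u hu
    have := hT.norm_le l u
    rw [← hL, hu, norm_zero] at this
    have h2 : ‖(u : H)‖ ≤ 0 := by nlinarith [norm_nonneg (u : H)]
    exact Subtype.ext (norm_le_zero_iff.mp h2)
  let e := LinearEquiv.ofBijective L ⟨hinj, hsurj⟩
  have he : ∀ y, T (e.symm y) - l • (e.symm y : H) = y := fun y => e.apply_symm_apply y
  refine ⟨(T.domain.subtype ∘ₗ e.symm.toLinearMap).mkContinuous (-l.re)⁻¹ ?_,
    LinearMap.mkContinuous_norm_le _ (inv_nonneg.mpr hl'.le) _, ?_, ?_⟩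
  · intro y
    have := hT.norm_le l (e.symm y)
    rw [he] at this
    rw [inv_mul_eq_div, le_div_iff₀ hl', mul_comm]
    exact this
  · exact fun y => ⟨e.symm y, rfl, he y⟩
  · intro u
    exact congrArg Subtype.val (e.symm_apply_apply u)

section

variable [CompleteSpace H]

/-- With `R` the resolvent of `T` at `l`, `(T + K - l) R = 1 + K R`, which is invertible by the
Neumann series because `‖R‖ ≤ 1 / (-Re l)`. -/
theorem IsAccretive.surjective_addBounded_of_norm_lt {T : H →ₗ.[ℂ] H} (hT : T.IsAccretive) {l : ℂ}
    (hl : l.re < 0) (hsurj : ∀ y : H, ∃ u : T.domain, T u - l • (u : H) = y)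
    (K : H →L[ℂ] H) (hK : ‖K‖ < -l.re) (y : H) :
    ∃ u : T.domain, K u + T u - l • (u : H) = y := by
  obtain ⟨R, hR, hR1, -⟩ := hT.exists_resolvent hl hsurj
  have hl' : 0 < -l.re := by linarith
  have hlt : ‖-(K * R)‖ < 1 := by
    rw [norm_neg]
    calc ‖K * R‖ ≤ ‖K‖ * ‖R‖ := norm_mul_le _ _
      _ ≤ ‖K‖ * (-l.re)⁻¹ := by gcongr
      _ < 1 := by rwa [← div_eq_mul_inv, div_lt_one hl']
  obtain ⟨g, hg⟩ : ∃ g, (1 - -(K * R)) g = y := by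
    have hu := (Units.oneSub _ hlt).mul_inv
    exact ⟨(↑(Units.oneSub _ hlt)⁻¹ : H →L[ℂ] H) y, congrArg (fun Q : H →L[ℂ] H => Q y) hu⟩
  obtain ⟨u, hu1, hu2⟩ := hR1 g
  refine ⟨u, ?_⟩
  rw [add_sub_assoc, hu2, hu1, ← hg]
  simp [add_comm]

/-- Continuity method: `K` is added in `n` equal steps, each of norm below `-Re l`. Accretivity
survives every step, so the resolvent bound, and with it the admissible step size, never
deteriorates. -/
theorem IsAccretive.surjective_addBounded {T : H →ₗ.[ℂ] H} (hT : T.IsAccretive) {l : ℂ}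
    (hl : l.re < 0) (hsurj : ∀ y : H, ∃ u : T.domain, T u - l • (u : H) = y)
    (K : H →L[ℂ] H) (hK : ∀ x : H, 0 ≤ (inner ℂ x (K x)).re) (y : H) :
    ∃ u : T.domain, K u + T u - l • (u : H) = y := by
  have hl' : 0 < -l.re := by linarith
  obtain ⟨n, hn⟩ := exists_nat_gt (‖K‖ / -l.re)
  have hn0 : (0 : ℝ) < n := lt_of_le_of_lt (by positivity) hn
  have key : ∀ m : ℕ, ∀ y : H, ∃ u : T.domain,
      (((m / n : ℝ) : ℂ) • K) u + T u - l • (u : H) = y := by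
    intro m
    induction m with
    | zero => simpa using hsurj
    | succ m ih =>
      intro y
      have hacc : (T.addBounded (((m / n : ℝ) : ℂ) • K)).IsAccretive := by
        refine hT.addBounded fun x => ?_
        rw [_root_.smul_apply, inner_smul_right, Complex.re_ofReal_mul]
        exact mul_nonneg (by positivity) (hK x)
      obtain ⟨u, hu⟩ := hacc.surjective_addBounded_of_norm_lt hl ih (((1 / n : ℝ) : ℂ) • K) (by
        rw [norm_smul, Complex.norm_real, Real.norm_of_nonneg (by positivity), one_div,
          inv_mul_eq_div, div_lt_iff₀ hn0]
        rwa [div_lt_iff₀ hl', mul_comm] at hn) y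
      refine ⟨u, ?_⟩
      rw [← hu, show (T.addBounded (((m / n : ℝ) : ℂ) • K)) u = (((m / n : ℝ) : ℂ) • K) u + T u
        from rfl, ← add_assoc, ← _root_.add_apply, ← add_smul]
      congr 5
      push_cast
      ring
  obtain ⟨u, hu⟩ := key n y
  rw [div_self hn0.ne', Complex.ofReal_one, one_smul] at hu
  exact ⟨u, hu⟩

theorem IsMAccretive.addBounded {T : H →ₗ.[ℂ] H} (hT : T.IsMAccretive) {K : H →L[ℂ] H}
    (hK : ∀ x : H, 0 ≤ (inner ℂ x (K x)).re) : (T.addBounded K).IsMAccretive := by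
  obtain ⟨h1, h2, l, hl, h3⟩ := hT
  exact ⟨h1.addBounded hK, h2, l, hl, h1.surjective_addBounded hl h3 K hK⟩

theorem IsMAccretive.exists_forall_ge {T : H →ₗ.[ℂ] H} (hT : T.IsMAccretive) :
    ∃ t₀ : ℝ, 0 < t₀ ∧ ∀ t : ℝ, t₀ ≤ t → ∀ y : H, ∃ u : T.domain, T u + (t : ℂ) • (u : H) = y := by
  obtain ⟨h1, -, l, hl, h3⟩ := hT
  refine ⟨-l.re, by linarith, fun t ht y => ?_⟩
  -- Moving the spectral point from `l` to `-t` amounts to adding `(l + t) I`, which is accretive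
  -- once `t ≥ -Re l`.
  obtain ⟨u, hu⟩ := h1.surjective_addBounded hl h3 ((l + t) • ContinuousLinearMap.id ℂ H) (by
    intro x
    rw [_root_.smul_apply, ContinuousLinearMap.id_apply, re_inner_smul_self]
    exact mul_nonneg (by simp; linarith) (by positivity)) y
  refine ⟨u, ?_⟩
  rw [← hu, _root_.smul_apply, ContinuousLinearMap.id_apply, add_smul]
  abel

/-! ### Adjoints of m-accretive operators -/

/-- If the form of an m-accretive operator `T` is in the half-plane `Re (c z) ≥ 0`, `Re c ≥ 0`,
then the form of `T†` is in the complex conjugate half-plane. -/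
theorem IsMAccretive.formNonneg_adjoint {T : H →ₗ.[ℂ] H} (hT : T.IsMAccretive) {c : ℂ}
    (hc : 0 ≤ c.re) (h : T.FormNonneg c) : T†.FormNonneg (conj c) := by
  intro v
  obtain ⟨t₀, ht₀, hsurj⟩ := hT.exists_forall_ge
  have hacc := isAccretive_iff.mp hT.1
  have hdense := hT.2.1
  set w := T† v with hw
  have hconj : (conj c * inner ℂ (v : H) w).re = (c * inner ℂ w (v : H)).re := by
    rw [← inner_conj_symm (v : H) w, ← map_mul, Complex.conj_re]
  rw [hconj]
  by_contra! hneg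
  set d := -(c * inner ℂ w (v : H)).re with hd
  have hd0 : 0 < d := by linarith
  -- Approximate `v` by `u = t (T + t)⁻¹ v` in `dom T`. Then `t (v, Tu)` splits into `‖Tu‖²` and `t`
  -- times the form of `T` at `u`, so `Re (c · inner w u) ≥ 0`, while `t ‖u - v‖²` stays bounded. A
  -- defect `d > 0` at `v` would make `t d²` bounded as `t → ∞`.
  have key : ∀ t : ℝ, t₀ ≤ t → t * d ^ 2 ≤ (‖c‖ * ‖w‖) ^ 2 * (‖w‖ * ‖(v : H)‖) := by
    intro t ht
    have ht0 : 0 < t := ht₀.trans_le ht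
    obtain ⟨u, hu⟩ := hsurj t ht ((t : ℂ) • (v : H))
    have e1 : inner ℂ w (u : H) = inner ℂ (v : H) (T u) :=
      adjoint_isFormalAdjoint hdense v u
    have e2 : (t : ℂ) * inner ℂ w (u : H) =
        (‖T u‖ ^ 2 : ℝ) + t * inner ℂ (u : H) (T u) := by
      have : inner ℂ ((t : ℂ) • (v : H)) (T u) = (t : ℂ) * inner ℂ w (u : H) := by
        rw [inner_smul_left, Complex.conj_ofReal, e1]
      rw [← this, ← hu, inner_add_left, inner_smul_left, Complex.conj_ofReal,
        inner_self_eq_norm_sq_to_K]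
      norm_cast
    have e3 : 0 ≤ (c * inner ℂ w (u : H)).re := by
      have : (t : ℂ) * (c * inner ℂ w (u : H)) =
          (‖T u‖ ^ 2 : ℝ) * c + t * (c * inner ℂ (u : H) (T u)) := by
        rw [mul_left_comm, e2]; ring
      have h2 := congrArg Complex.re this
      rw [Complex.add_re, Complex.re_ofReal_mul, Complex.re_ofReal_mul, Complex.re_ofReal_mul] at h2
      have h3 : 0 ≤ t * (c * inner ℂ w (u : H)).re := by
        rw [h2]
        exact add_nonneg (mul_nonneg (by positivity) hc) (mul_nonneg ht0.le (h u))
      exact nonneg_of_mul_nonneg_right h3 ht0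
    have e4 : ‖T u‖ ^ 2 ≤ t * (‖w‖ * ‖(u : H)‖) := by
      have h2 := congrArg Complex.re e2
      rw [Complex.add_re, Complex.re_ofReal_mul, Complex.re_ofReal_mul, Complex.ofReal_re] at h2
      have h3 := (Complex.re_le_norm _).trans (norm_inner_le_norm (𝕜 := ℂ) w (u : H))
      nlinarith [mul_nonneg ht0.le (hacc u), mul_le_mul_of_nonneg_left h3 ht0.le]
    have e5 : ‖(u : H)‖ ≤ ‖(v : H)‖ := by
      have := hT.1.norm_le (-(t : ℂ)) u
      rw [neg_smul, sub_neg_eq_add, hu, norm_smul, Complex.norm_real,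
        Real.norm_of_nonneg ht0.le] at this
      simp only [Complex.neg_re, Complex.ofReal_re, neg_neg] at this
      exact le_of_mul_le_mul_left this ht0
    have e6 : t * ‖(u : H) - v‖ ^ 2 ≤ ‖w‖ * ‖(v : H)‖ := by
      have h1 : T u = (t : ℂ) • ((v : H) - u) := by
        rw [smul_sub, ← hu]; abel
      rw [h1, norm_smul, Complex.norm_real, Real.norm_of_nonneg ht0.le, norm_sub_rev] at e4
      have : t * (t * ‖(u : H) - v‖ ^ 2) ≤ t * (‖w‖ * ‖(v : H)‖) := by
        calc t * (t * ‖(u : H) - v‖ ^ 2) = (t * ‖(u : H) - v‖) ^ 2 := by ring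
          _ ≤ _ := e4
          _ ≤ _ := by gcongr
      exact le_of_mul_le_mul_left this ht0
    have e7 : d ≤ ‖c‖ * ‖w‖ * ‖(u : H) - v‖ := by
      have h1 : d ≤ (c * inner ℂ w ((u : H) - v)).re := by
        rw [inner_sub_right, mul_sub, Complex.sub_re]
        linarith
      refine h1.trans ((Complex.re_le_norm _).trans ?_)
      rw [norm_mul, mul_assoc]
      gcongr
      exact norm_inner_le_norm _ _
    calc t * d ^ 2 ≤ t * (‖c‖ * ‖w‖ * ‖(u : H) - v‖) ^ 2 := by gcongr
      _ = (‖c‖ * ‖w‖) ^ 2 * (t * ‖(u : H) - v‖ ^ 2) := by ring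
      _ ≤ _ := by gcongr
  set C := (‖c‖ * ‖w‖) ^ 2 * (‖w‖ * ‖(v : H)‖)
  have h1 := key (max t₀ ((C + 1) / d ^ 2)) (le_max_left _ _)
  have h2 : (C + 1) / d ^ 2 * d ^ 2 ≤ max t₀ ((C + 1) / d ^ 2) * d ^ 2 := by
    gcongr
    exact le_max_right _ _
  rw [div_mul_cancel₀ _ (by positivity)] at h2
  linarith

theorem IsMAccretive.adjoint {T : H →ₗ.[ℂ] H} (hT : T.IsMAccretive) : T†.IsMAccretive := by
  have hacc : T†.IsAccretive := by
    have := hT.formNonneg_adjoint (c := 1) (by simp) (isAccretive_iff_formNonneg.mp hT.1)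
    rw [map_one] at this
    exact isAccretive_iff_formNonneg.mpr this
  obtain ⟨h1, hd, l, hl, hsurj⟩ := hT
  obtain ⟨R, -, hR, hR'⟩ := h1.exists_resolvent hl hsurj
  have key : ∀ y : H, ∀ u : T.domain,
      inner ℂ (y + conj l • ContinuousLinearMap.adjoint R y) (u : H) =
        inner ℂ (ContinuousLinearMap.adjoint R y) (T u) := by
    intro y u
    have h2 : T u = (T u - l • (u : H)) + l • (u : H) := by abel
    rw [h2, inner_add_right, ContinuousLinearMap.adjoint_inner_left, hR' u, inner_add_left,
      inner_smul_left, inner_smul_right, Complex.conj_conj]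
  have hmem : ∀ y, ContinuousLinearMap.adjoint R y ∈ T†.domain := fun y =>
    mem_adjoint_domain_of_exists _ ⟨_, key y⟩
  refine ⟨hacc, ?_, conj l, by simpa using hl, fun y => ⟨⟨_, hmem y⟩, ?_⟩⟩
  · rw [Submodule.dense_iff_topologicalClosure_eq_top, Submodule.topologicalClosure_eq_top_iff,
      Submodule.eq_bot_iff]
    -- Testing `w ⊥ dom T†` against `R* R w` gives `‖R w‖² = 0`, and the resolvent `R` is injective.
    intro w hw
    have hRw : R w = 0 := by
      have := (Submodule.mem_orthogonal _ _).mp hw _ (hmem (R w))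
      rwa [ContinuousLinearMap.adjoint_inner_left, inner_self_eq_zero] at this
    obtain ⟨u, hu, hu'⟩ := hR w
    have : u = 0 := Subtype.ext (hu.trans hRw)
    rw [← hu', this]
    simp
  · rw [adjoint_apply_eq hd ⟨_, hmem y⟩ (key y)]
    simp

/-- An m-accretive operator has no proper accretive extension: `T + t` is already onto, while
accretivity of `T††` makes `T†† + t` injective. -/
theorem IsMAccretive.adjoint_adjoint {T : H →ₗ.[ℂ] H} (hT : T.IsMAccretive) : T†† = T := by
  have hle : T ≤ T†† := (adjoint_isFormalAdjoint hT.2.1).le_adjoint hT.adjoint.2.1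
  symm
  refine eq_of_le_of_domain_eq hle (le_antisymm hle.1 fun x hx => ?_)
  obtain ⟨t, ht0, hsurj⟩ := hT.exists_forall_ge
  obtain ⟨u, hu⟩ := hsurj t le_rfl (T†† ⟨x, hx⟩ + (t : ℂ) • x)
  have hacc := hT.adjoint.adjoint.1
  let u' : T††.domain := ⟨u, hle.1 u.2⟩
  have hu' : T u = T†† u' := hle.2 rfl
  have h2 := hacc.norm_le (-(t : ℂ)) (u' - ⟨x, hx⟩)
  have h3 : T†† (u' - ⟨x, hx⟩) - (-(t : ℂ)) • ((u' - ⟨x, hx⟩ : T††.domain) : H) = 0 := by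
    rw [LinearPMap.map_sub, ← hu', Submodule.coe_sub, neg_smul, sub_neg_eq_add, smul_sub]
    rw [← sub_eq_zero] at hu
    rw [← hu]
    abel
  rw [h3, norm_zero] at h2
  simp only [Complex.neg_re, Complex.ofReal_re, neg_neg] at h2
  have h4 : ‖((u' - ⟨x, hx⟩ : T††.domain) : H)‖ ≤ 0 := by
    by_contra! h5
    exact absurd h2 (not_le.mpr (mul_pos ht0 h5))
  have h5 : (u : H) = x := sub_eq_zero.mp (norm_le_zero_iff.mp h4)
  rw [← h5]
  exact u.2

theorem IsMAccretive.isSectorial_adjoint_iff {T : H →ₗ.[ℂ] H} (hT : T.IsMAccretive) :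
    T†.IsSectorial ↔ T.IsSectorial := by
  have key : ∀ {S : H →ₗ.[ℂ] H}, S.IsMAccretive → S.IsSectorial → S†.IsSectorial := by
    intro S hS h
    obtain ⟨-, k, hk, h1, h2⟩ := isSectorial_iff.mp h
    refine isSectorial_iff.mpr ⟨hS.adjoint.1, k, hk, ?_, ?_⟩
    · simpa [sub_eq_add_neg] using hS.formNonneg_adjoint (by simpa using hk) h2
    · simpa using hS.formNonneg_adjoint (by simpa using hk) h1
  refine ⟨fun h => ?_, key hT⟩
  rw [← hT.adjoint_adjoint]
  exact key hT.adjoint h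

theorem adjoint_addBounded {T : H →ₗ.[ℂ] H} (hT : Dense (T.domain : Set H)) (K : H →L[ℂ] H) :
    (T.addBounded K)† = T†.addBounded (ContinuousLinearMap.adjoint K) := by
  have hT' : Dense ((T.addBounded K).domain : Set H) := hT
  have hform : (T.addBounded K).IsFormalAdjoint
      (T†.addBounded (ContinuousLinearMap.adjoint K)) := by
    intro u v
    change inner ℂ (K u + T u) (v : H) = inner ℂ (u : H) (ContinuousLinearMap.adjoint K v + T† v)
    rw [inner_add_left, inner_add_right, ContinuousLinearMap.adjoint_inner_right,
      (adjoint_isFormalAdjoint hT).symm u v]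
  have hle := hform.le_adjoint hT'
  refine (eq_of_le_of_domain_eq hle (le_antisymm hle.1 fun x hx => ?_)).symm
  refine mem_adjoint_domain_of_exists _
    ⟨(T.addBounded K)† ⟨x, hx⟩ - ContinuousLinearMap.adjoint K x, fun u => ?_⟩
  rw [inner_sub_left, adjoint_isFormalAdjoint hT' ⟨x, hx⟩ u,
    ContinuousLinearMap.adjoint_inner_left]
  change inner ℂ x (K u + T u) - _ = _
  rw [inner_add_right, add_sub_cancel_left]

end

theorem addI_apply (A : H →ₗ.[ℂ] H) (B : H →L[ℂ] H) (u : A.domain) :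
    (A.addI B) u = Complex.I • B u + A u := rfl

/-! ### Sectorial operators with full range -/

/-- A Cauchy–Schwarz inequality for sectorial forms, in the special case `u = A w`. -/
theorem two_mul_norm_sq_le {A : H →ₗ.[ℂ] H} {k : ℝ}
    (hre : ∀ u : A.domain, 0 ≤ (inner ℂ (u : H) (A u)).re)
    (him : ∀ u : A.domain, |(inner ℂ (u : H) (A u)).im| ≤ k * (inner ℂ (u : H) (A u)).re)
    {u w : A.domain} (hw : A w = u) (s : ℝ) :
    2 * s * ‖(u : H)‖ ^ 2 ≤
      (1 + k) * ((inner ℂ (u : H) (A u)).re + s ^ 2 * (inner ℂ (w : H) (A w)).re) := by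
  have hself : inner ℂ (u : H) (A w) = ((‖(u : H)‖ ^ 2 : ℝ) : ℂ) := by
    rw [hw, inner_self_eq_norm_sq_to_K]
    norm_cast
  set p := inner ℂ (u : H) (A u)
  set q := inner ℂ (w : H) (A w)
  set b := inner ℂ (w : H) (A u)
  have expand : ∀ c : ℂ, inner ℂ ((u + c • w : A.domain) : H) (A (u + c • w)) =
      p + c * ((‖(u : H)‖ ^ 2 : ℝ) : ℂ) + conj c * b + conj c * c * q := by
    intro c
    rw [LinearPMap.map_add, LinearPMap.map_smul, Submodule.coe_add, Submodule.coe_smul,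
      inner_add_left, inner_add_right, inner_add_right, inner_smul_left, inner_smul_left,
      inner_smul_right, inner_smul_right, hself]
    ring
  -- The choice `c = -s` bounds `s (‖u‖² + Re b)`, and the difference of the imaginary parts at `c =
  -- ±is` bounds `s (‖u‖² - Re b)`; in the sum the unknown cross term `b` cancels.
  have h1 := hre (u + (-s : ℂ) • w)
  have h2 := abs_le.mp (him (u + (s * Complex.I : ℂ) • w))
  have h3 := abs_le.mp (him (u + (-(s * Complex.I) : ℂ) • w))
  rw [expand] at h1 h2 h3
  generalize ‖(u : H)‖ ^ 2 = n at *
  simp [Complex.mul_re, Complex.mul_im] at h1 h2 h3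
  nlinarith [h1, h2.1, h2.2, h3.1, h3.2]

theorem IsMSectorial.ker_eq_bot {A : H →ₗ.[ℂ] H} (hA : A.IsMSectorial)
    (hran : LinearMap.range A.toFun = ⊤) : LinearMap.ker A.toFun = ⊥ := by
  obtain ⟨k, hk, him⟩ := hA.1.exists_abs_im_le
  have hre := isAccretive_iff.mp hA.2.1
  rw [LinearMap.ker_eq_bot']
  intro u hu
  obtain ⟨w, hw⟩ := LinearMap.range_eq_top.mp hran (u : H)
  have key := fun s => two_mul_norm_sq_le hre him hw s
  have hu' : A u = 0 := hu
  simp only [hu', inner_zero_right, Complex.zero_re, zero_add] at key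
  set q := (inner ℂ (w : H) (A w)).re
  have hq : 0 ≤ q := hre w
  by_contra hne
  have hpos : 0 < ‖(u : H)‖ ^ 2 := by
    have : (u : H) ≠ 0 := fun h => hne (Subtype.ext h)
    positivity
  have hK : 0 < (1 + k) * q + 1 := by positivity
  -- With `Au = 0` the estimate reads `2 s ‖u‖² ≤ (1 + k) q s²`, which fails for small `s > 0`; the
  -- `+ 1` keeps the denominator positive when `q = 0`.
  have h1 := key (‖(u : H)‖ ^ 2 / ((1 + k) * q + 1))
  set n := ‖(u : H)‖ ^ 2
  set K := (1 + k) * q + 1 with hKdef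
  have h2 : 2 * (n / K) * n ≤ (K - 1) * (n / K) ^ 2 := by
    rw [hKdef]; linarith
  have h3 : K * (n / K) ^ 2 = n / K * n := by
    field_simp
  have h4 : 0 < n / K * n := by positivity
  nlinarith [sq_nonneg (n / K)]

section

variable [CompleteSpace H]

theorem IsMSectorial.exists_norm_sq_le {A : H →ₗ.[ℂ] H} (hA : A.IsMSectorial)
    (hran : LinearMap.range A.toFun = ⊤) :
    ∃ C : ℝ, 0 ≤ C ∧ ∀ u : A.domain, ‖(u : H)‖ ^ 2 ≤ C * (inner ℂ (u : H) (A u)).re := by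
  obtain ⟨k, hk, him⟩ := hA.1.exists_abs_im_le
  have hre := isAccretive_iff.mp hA.2.1
  have hker := hA.ker_eq_bot hran
  obtain ⟨-, hacc, -, l, hl, hsurj⟩ := hA
  obtain ⟨R, -, hR, hR'⟩ := hacc.exists_resolvent hl hsurj
  let e := LinearEquiv.ofBijective A.toFun
    ⟨LinearMap.ker_eq_bot.mp hker, LinearMap.range_eq_top.mp hran⟩
  have he : ∀ y, A (e.symm y) = y := fun y => e.apply_symm_apply y
  let G : H →ₗ[ℂ] H := A.domain.subtype ∘ₗ e.symm.toLinearMap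
  have hG : ∀ y, G y = (e.symm y : H) := fun y => rfl
  have hGR : ∀ y, G y = R (y - l • G y) := by
    intro y
    have := hR' (e.symm y)
    rw [he] at this
    exact this.symm
  -- Closed graph theorem: the identity `G y = R (y - l G y)` passes to the limit, so the inverse of
  -- `A` is closed and everywhere defined.
  have hcont : Continuous G := by
    refine G.continuous_of_seq_closed_graph fun x a b hx hGx => ?_
    have h1 : Filter.Tendsto (fun n => R (x n - l • G (x n))) Filter.atTop
        (nhds (R (a - l • b))) :=
      (R.continuous.tendsto _).comp (hx.sub (hGx.const_smul l))
    have h2 : b = R (a - l • b) := by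
      refine tendsto_nhds_unique hGx ?_
      convert h1 using 2 with n
      exact hGR _
    obtain ⟨u, hu, hu'⟩ := hR (a - l • b)
    rw [← h2] at hu
    rw [hu, sub_left_inj] at hu'
    rw [← hu, hG, ← hu']
    exact congrArg Subtype.val (e.symm_apply_apply u).symm
  let G' : H →L[ℂ] H := ⟨G, hcont⟩
  set M := ‖G'‖ + 1
  have hM : 0 < M := by positivity
  refine ⟨(1 + k) * ((1 + k) * M), by positivity, fun u => ?_⟩
  -- This `s` makes the term with `w = A⁻¹ u` at most `s ‖u‖²`, half of the left-hand side, so it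
  -- can be absorbed.
  have h1 := two_mul_norm_sq_le hre him (he u) ((1 + k) * M)⁻¹
  have h2 : (inner ℂ (e.symm (u : H) : H) (A (e.symm (u : H)))).re ≤ M * ‖(u : H)‖ ^ 2 := by
    rw [he]
    refine (Complex.re_le_norm _).trans ((norm_inner_le_norm _ _).trans ?_)
    have h3 : ‖(e.symm (u : H) : H)‖ ≤ M * ‖(u : H)‖ :=
      (G'.le_opNorm u).trans (by gcongr; exact le_add_of_nonneg_right zero_le_one)
    calc _ ≤ M * ‖(u : H)‖ * ‖(u : H)‖ := by gcongr
      _ = _ := by ring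
  set p := (inner ℂ (u : H) (A u)).re
  set s := ((1 + k) * M)⁻¹
  have hs : 0 < s := by positivity
  have hs1 : (1 + k) * M * s = 1 := mul_inv_cancel₀ (by positivity)
  have h4 : s * ‖(u : H)‖ ^ 2 ≤ (1 + k) * p := by
    have h5 : (1 + k) * (s ^ 2 * (inner ℂ (e.symm (u : H) : H) (A (e.symm (u : H)))).re) ≤
        (1 + k) * (s ^ 2 * (M * ‖(u : H)‖ ^ 2)) := by gcongr
    have h6 : (1 + k) * (s ^ 2 * (M * ‖(u : H)‖ ^ 2)) = s * ‖(u : H)‖ ^ 2 := by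
      calc _ = ((1 + k) * M * s) * (s * ‖(u : H)‖ ^ 2) := by ring
        _ = _ := by rw [hs1, one_mul]
    linarith
  have h7 := mul_le_mul_of_nonneg_left h4 (by positivity : 0 ≤ (1 + k) * M)
  rw [← mul_assoc, hs1, one_mul] at h7
  linarith

/-! ### The perturbation by `iB` -/

theorem im_inner_self_of_isSelfAdjoint {B : H →L[ℂ] H} (hB : IsSelfAdjoint B) (x : H) :
    (inner ℂ x (B x)).im = 0 := by
  rw [← Complex.conj_eq_iff_im, inner_conj_symm]
  exact hB.isSymmetric x x

theorem re_inner_I_smul_of_isSelfAdjoint {B : H →L[ℂ] H} (hB : IsSelfAdjoint B) (x : H) :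
    (inner ℂ x ((Complex.I • B) x)).re = 0 := by
  rw [_root_.smul_apply, inner_smul_right, Complex.I_mul_re,
    im_inner_self_of_isSelfAdjoint hB, neg_zero]

theorem inner_addI {B : H →L[ℂ] H} (hB : IsSelfAdjoint B) (A : H →ₗ.[ℂ] H) (u : A.domain) :
    (inner ℂ (u : H) ((A.addI B) u)).re = (inner ℂ (u : H) (A u)).re ∧
    (inner ℂ (u : H) ((A.addI B) u)).im =
      (inner ℂ (u : H) (B u)).re + (inner ℂ (u : H) (A u)).im := by
  rw [addI_apply, inner_add_right, inner_smul_right]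
  simp [im_inner_self_of_isSelfAdjoint hB]

theorem norm_inner_of_isSelfAdjoint {B : H →L[ℂ] H} (hB : IsSelfAdjoint B) (x : H) :
    ‖inner ℂ x (B x)‖ = |(inner ℂ x (B x)).re| :=
  (Complex.abs_re_eq_norm.mpr (im_inner_self_of_isSelfAdjoint hB x)).symm

theorem IsMAccretive.addI {A : H →ₗ.[ℂ] H} (hA : A.IsMAccretive) {B : H →L[ℂ] H}
    (hB : IsSelfAdjoint B) : (A.addI B).IsMAccretive :=
  hA.addBounded fun x => (re_inner_I_smul_of_isSelfAdjoint hB x).ge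

theorem adjoint_addI {A : H →ₗ.[ℂ] H} (hA : Dense (A.domain : Set H)) {B : H →L[ℂ] H}
    (hB : IsSelfAdjoint B) : (A.addI B)† = A†.addBounded (-(Complex.I • B)) := by
  rw [LinearPMap.addI, adjoint_addBounded hA]
  congr 1
  rw [← ContinuousLinearMap.star_eq_adjoint, star_smul, hB.star_eq]
  simp

theorem IsMSectorial.addI {A : H →ₗ.[ℂ] H} (hA : A.IsMSectorial)
    (hran : LinearMap.range A.toFun = ⊤) {B : H →L[ℂ] H}
    (hB : IsSelfAdjoint B) : (A.addI B).IsMSectorial := by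
  have hm := hA.2.addI hB
  refine ⟨?_, hm⟩
  obtain ⟨k, hk, him⟩ := hA.1.exists_abs_im_le
  obtain ⟨C, hC, hCu⟩ := hA.exists_norm_sq_le hran
  have key : ∀ u : A.domain, |(inner ℂ (u : H) ((A.addI B) u)).im| ≤
      (k + ‖B‖ * C) * (inner ℂ (u : H) ((A.addI B) u)).re := by
    intro u
    rw [(inner_addI hB A u).1, (inner_addI hB A u).2]
    have h1 : |(inner ℂ (u : H) (B u)).re| ≤ ‖B‖ * ‖(u : H)‖ ^ 2 := by
      refine (Complex.abs_re_le_norm _).trans ((norm_inner_le_norm _ _).trans ?_)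
      calc ‖(u : H)‖ * ‖B u‖ ≤ ‖(u : H)‖ * (‖B‖ * ‖(u : H)‖) := by
            gcongr; exact B.le_opNorm _
        _ = _ := by ring
    have h2 := mul_le_mul_of_nonneg_left (hCu u) (norm_nonneg B)
    have h3 := him u
    have h4 := abs_add_le (inner ℂ (u : H) (B u)).re (inner ℂ (u : H) (A u)).im
    linarith
  refine isSectorial_iff.mpr ⟨hm.1, k + ‖B‖ * C, by positivity, fun u => ?_, fun u => ?_⟩
  · rw [re_ofReal_sub_I_mul]
    linarith [(abs_le.mp (key u)).1]
  · rw [re_ofReal_add_I_mul]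
    linarith [(abs_le.mp (key u)).2]

/-- Where `Re (Au,u) = 0` the quotient is `0` by convention; nothing is lost, since the assumed
bound forces `(Bu,u) = 0` there. -/
theorem bddAbove_of_abs_re_inner_le {A : H →ₗ.[ℂ] H} {B : H →L[ℂ] H} (hA : A.IsAccretive)
    (hB : IsSelfAdjoint B) {C : ℝ} (hC : 0 ≤ C)
    (h : ∀ u : A.domain, |(inner ℂ (u : H) (B u)).re| ≤ C * (inner ℂ (u : H) (A u)).re) :
    BddAbove {t : ℝ | ∃ u : A.domain, u ≠ 0 ∧
      t = ‖inner ℂ (u : H) (B u)‖ / (inner ℂ (u : H) (A u)).re} := by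
  refine ⟨C, ?_⟩
  rintro t ⟨u, -, rfl⟩
  rw [norm_inner_of_isSelfAdjoint hB]
  exact div_le_of_le_mul₀ (isAccretive_iff.mp hA u) hC (h u)

theorem bddAbove_of_isSectorial_addI {A : H →ₗ.[ℂ] H} {B : H →L[ℂ] H} (hA : A.IsSectorial)
    (hB : IsSelfAdjoint B) (h : (A.addI B).IsSectorial) :
    BddAbove {t : ℝ | ∃ u : A.domain, u ≠ 0 ∧
      t = ‖inner ℂ (u : H) (B u)‖ / (inner ℂ (u : H) (A u)).re} := by
  obtain ⟨k, hk, him⟩ := hA.exists_abs_im_le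
  obtain ⟨k', hk', him'⟩ := h.exists_abs_im_le
  refine bddAbove_of_abs_re_inner_le hA.isAccretive hB (add_nonneg hk hk') fun u => ?_
  have h1 := abs_le.mp (him u)
  have h2 := him' u
  rw [(inner_addI hB A u).1, (inner_addI hB A u).2] at h2
  have h2 := abs_le.mp h2
  rw [abs_le]
  constructor <;> linarith [h1.1, h1.2, h2.1, h2.2]

end

/-! ### Operator matrices in `H ⊕ H` -/

theorem dense_directSum {p q : Submodule ℂ H} (hp : Dense (p : Set H)) (hq : Dense (q : Set H)) :
    Dense (directSum p q : Set (WithLp 2 (H × H))) := by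
  have h := (hp.prod hq).preimage (WithLp.prodContinuousLinearEquiv 2 ℂ H H).toHomeomorph.isOpenMap
  exact h

theorem mem_directSum {p q : Submodule ℂ H} {x : WithLp 2 (H × H)} :
    x ∈ directSum p q ↔ x.fst ∈ p ∧ x.snd ∈ q := Iff.rfl

theorem directSum_inf_directSum (p q p' q' : Submodule ℂ H) :
    directSum p q ⊓ directSum p' q' = directSum (p ⊓ p') (q ⊓ q') := by
  ext x
  simp only [Submodule.mem_inf, mem_directSum]
  tauto

theorem inner_blockMatrix (P : H →ₗ.[ℂ] H) (X Y : H →L[ℂ] H) (Q : H →ₗ.[ℂ] H)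
    (x : WithLp 2 (H × H)) (w : (blockMatrix P X Y Q).domain) :
    inner ℂ x (blockMatrix P X Y Q w) =
      inner ℂ x.fst (P ⟨w.1.fst, w.2.1⟩ + X w.1.snd) +
        inner ℂ x.snd (Y w.1.fst + Q ⟨w.1.snd, w.2.2⟩) := rfl

/-- The vector `(u, v)` of the domain of an operator matrix. -/
def blockVector {P : H →ₗ.[ℂ] H} {X Y : H →L[ℂ] H} {Q : H →ₗ.[ℂ] H} (u : P.domain)
    (v : Q.domain) : (blockMatrix P X Y Q).domain :=
  ⟨WithLp.toLp 2 (u, v), u.2, v.2⟩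

theorem inner_blockVector {P : H →ₗ.[ℂ] H} {X Y : H →L[ℂ] H} {Q : H →ₗ.[ℂ] H} (u : P.domain)
    (v : Q.domain) :
    inner ℂ (blockVector u v : (blockMatrix P X Y Q).domain).1
      (blockMatrix P X Y Q (blockVector u v)) =
      inner ℂ (u : H) (P u + X v) + inner ℂ (v : H) (Y u + Q v) := rfl

/-- The bounded operator matrix `[0, K; K, 0]`. -/
def offDiagonal (K : H →L[ℂ] H) : WithLp 2 (H × H) →L[ℂ] WithLp 2 (H × H) :=
  (WithLp.prodContinuousLinearEquiv 2 ℂ H H).symm.toContinuousLinearMap ∘L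
    ((K ∘L ContinuousLinearMap.snd ℂ H H).prod (K ∘L ContinuousLinearMap.fst ℂ H H)) ∘L
      (WithLp.prodContinuousLinearEquiv 2 ℂ H H).toContinuousLinearMap

theorem offDiagonal_apply (K : H →L[ℂ] H) (x : WithLp 2 (H × H)) :
    offDiagonal K x = WithLp.toLp 2 (K x.snd, K x.fst) := rfl

/-- Splitting off the bounded off-diagonal part, whose form is purely imaginary for selfadjoint `B`,
reduces m-accretivity and the adjoint domain to the block diagonal case. -/
theorem tildeOperator_eq (A : H →ₗ.[ℂ] H) (B : H →L[ℂ] H) :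
    A.tildeOperator B = (blockMatrix A 0 0 A).addBounded (offDiagonal (Complex.I • B)) := by
  refine LinearPMap.dExt rfl ?_
  rintro u v huv
  obtain rfl : u = v := Subtype.ext huv
  apply WithLp.ofLp_injective
  refine Prod.ext ?_ ?_
  · change A _ + (Complex.I • B) _ = (Complex.I • B) _ + (A _ + 0)
    rw [add_zero, add_comm]
    rfl
  · change (Complex.I • B) _ + A _ = (Complex.I • B) _ + (0 + A _)
    rw [zero_add]
    rfl

theorem FormNonneg.of_blockMatrix {P Q : H →ₗ.[ℂ] H} {X Y : H →L[ℂ] H} {c : ℂ}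
    (h : (LinearPMap.blockMatrix P X Y Q).FormNonneg c) : P.FormNonneg c ∧ Q.FormNonneg c := by
  constructor
  · intro u
    have := h (blockVector u 0)
    rw [inner_blockVector] at this
    simpa using this
  · intro u
    have := h (blockVector 0 u)
    rw [inner_blockVector] at this
    simpa using this

/-- An opening below `π` means that at least one bounding ray is off the imaginary axis, and that
ray bounds the imaginary part from one side. -/
theorem exists_formNonneg_of_numericalRange_subset {T : H →ₗ.[ℂ] H} {θ₁ θ₂ : ℝ}
    (h₁ : -(Real.pi / 2) ≤ θ₁) (h₁₂ : θ₁ ≤ θ₂) (h₂ : θ₂ ≤ Real.pi / 2) (h : θ₂ - θ₁ < Real.pi)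
    (hT : T.numericalRange ⊆ closedSector θ₁ θ₂) :
    ∃ k : ℝ, 0 ≤ k ∧ (T.FormNonneg (k - Complex.I) ∨ T.FormNonneg (k + Complex.I)) := by
  simp only [formNonneg_iff_numericalRange, re_ofReal_add_I_mul, re_ofReal_sub_I_mul]
  rcases h₁.eq_or_lt with rfl | h₁'
  · refine ⟨(Real.cos θ₂)⁻¹, inv_nonneg.mpr (Real.cos_nonneg_of_mem_Icc ⟨h₁₂, h₂⟩),
      Or.inr fun z hz => ?_⟩
    have := im_le_of_mem_closedSector h₁ (by linarith) h₁₂ (hT hz)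
    linarith
  · refine ⟨(Real.cos θ₁)⁻¹, inv_nonneg.mpr (Real.cos_nonneg_of_mem_Icc ⟨h₁, h₁₂.trans h₂⟩),
      Or.inl fun z hz => ?_⟩
    have := im_ge_of_mem_closedSector h₁' (h₁₂.trans h₂) h₂ (hT hz)
    linarith

variable [CompleteSpace H]

theorem IsMAccretive.blockMatrix {P Q : H →ₗ.[ℂ] H} (hP : P.IsMAccretive) (hQ : Q.IsMAccretive) :
    (blockMatrix P 0 0 Q).IsMAccretive := by
  refine ⟨?_, dense_directSum hP.2.1 hQ.2.1, ?_⟩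
  · rw [isAccretive_iff]
    intro w
    rw [inner_blockMatrix, Complex.add_re]
    simp only [_root_.zero_apply, add_zero, zero_add]
    exact add_nonneg (isAccretive_iff.mp hP.1 ⟨w.1.fst, w.2.1⟩)
      (isAccretive_iff.mp hQ.1 ⟨w.1.snd, w.2.2⟩)
  · obtain ⟨s, hs0, hs⟩ := hP.exists_forall_ge
    obtain ⟨t, ht0, ht⟩ := hQ.exists_forall_ge
    refine ⟨-((max s t : ℝ) : ℂ), by simp [hs0], fun y => ?_⟩
    obtain ⟨u, hu⟩ := hs (max s t) (le_max_left _ _) y.fst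
    obtain ⟨v, hv⟩ := ht (max s t) (le_max_right _ _) y.snd
    refine ⟨blockVector u v, ?_⟩
    rw [neg_smul, sub_neg_eq_add]
    apply WithLp.ofLp_injective
    refine Prod.ext ?_ ?_
    · rw [show y.ofLp.1 = y.fst from rfl, ← hu]
      change P u + 0 + _ = _
      rw [add_zero]
      rfl
    · rw [show y.ofLp.2 = y.snd from rfl, ← hv]
      change 0 + Q v + _ = _
      rw [zero_add]
      rfl

theorem adjoint_blockMatrix_domain {P Q : H →ₗ.[ℂ] H} (hP : Dense (P.domain : Set H))
    (hQ : Dense (Q.domain : Set H)) :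
    (blockMatrix P 0 0 Q)†.domain = directSum P†.domain Q†.domain := by
  have hd : Dense ((blockMatrix P 0 0 Q).domain : Set (WithLp 2 (H × H))) := dense_directSum hP hQ
  ext x
  rw [mem_directSum]
  constructor
  · intro hx
    have key := adjoint_isFormalAdjoint hd ⟨x, hx⟩
    set z := (LinearPMap.blockMatrix P 0 0 Q)† ⟨x, hx⟩
    constructor
    · refine mem_adjoint_domain_of_exists _ ⟨z.fst, fun u => ?_⟩
      have := key (blockVector u 0)
      rw [inner_blockMatrix] at this
      have h0 : Q ⟨0, Q.domain.zero_mem⟩ = 0 := Q.map_zero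
      simpa [blockVector, WithLp.prod_inner_apply, h0] using this
    · refine mem_adjoint_domain_of_exists _ ⟨z.snd, fun v => ?_⟩
      have := key (blockVector 0 v)
      rw [inner_blockMatrix] at this
      have h0 : P ⟨0, P.domain.zero_mem⟩ = 0 := P.map_zero
      simpa [blockVector, WithLp.prod_inner_apply, h0] using this
  · rintro ⟨h1, h2⟩
    refine mem_adjoint_domain_of_exists _
      ⟨WithLp.toLp 2 (P† ⟨x.fst, h1⟩, Q† ⟨x.snd, h2⟩), fun w => ?_⟩
    rw [inner_blockMatrix, WithLp.prod_inner_apply]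
    simp only [_root_.zero_apply, add_zero, zero_add]
    exact congrArg₂ (· + ·) (adjoint_isFormalAdjoint hP ⟨x.fst, h1⟩ ⟨w.1.fst, w.2.1⟩)
      (adjoint_isFormalAdjoint hQ ⟨x.snd, h2⟩ ⟨w.1.snd, w.2.2⟩)

theorem re_inner_offDiagonal {B : H →L[ℂ] H} (hB : IsSelfAdjoint B) (x : WithLp 2 (H × H)) :
    (inner ℂ x (offDiagonal (Complex.I • B) x)).re = 0 := by
  rw [offDiagonal_apply, WithLp.prod_inner_apply]
  have h : inner ℂ x.snd (B x.fst) = conj (inner ℂ x.fst (B x.snd)) := by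
    rw [inner_conj_symm]
    exact (hB.isSymmetric x.snd x.fst).symm
  change (inner ℂ x.fst ((Complex.I • B) x.snd) + inner ℂ x.snd ((Complex.I • B) x.fst)).re = 0
  rw [_root_.smul_apply, _root_.smul_apply, inner_smul_right, inner_smul_right, h, Complex.add_re,
    Complex.I_mul_re, Complex.I_mul_re, Complex.conj_im]
  ring

theorem IsMAccretive.tildeOperator {A : H →ₗ.[ℂ] H} (hA : A.IsMAccretive) {B : H →L[ℂ] H}
    (hB : IsSelfAdjoint B) : (A.tildeOperator B).IsMAccretive := by
  rw [tildeOperator_eq]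
  exact (hA.blockMatrix hA).addBounded fun x => (re_inner_offDiagonal hB x).ge

theorem adjoint_tildeOperator_domain {A : H →ₗ.[ℂ] H} (hA : Dense (A.domain : Set H))
    (B : H →L[ℂ] H) : (A.tildeOperator B)†.domain = directSum A†.domain A†.domain := by
  have hd : Dense ((blockMatrix A 0 0 A).domain : Set (WithLp 2 (H × H))) := dense_directSum hA hA
  rw [tildeOperator_eq, adjoint_addBounded hd, addBounded_domain,
    adjoint_blockMatrix_domain hA hA]

theorem hatOperator_eq {A : H →ₗ.[ℂ] H} (hA : Dense (A.domain : Set H)) {B : H →L[ℂ] H}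
    (hB : IsSelfAdjoint B) : A.hatOperator B = blockMatrix (A.addI B) 0 0 (A.addI B)† := by
  rw [hatOperator, adjoint_addI hA hB]

/-- Passing from `T†` back to `T†† = T` conjugates the half-plane, so the bound on `T†` supplies the
missing side for `T`. -/
theorem IsMAccretive.isSectorial_of_formNonneg_adjoint {T : H →ₗ.[ℂ] H} (hT : T.IsMAccretive)
    {k : ℝ} (hk : 0 ≤ k)
    (h : T.FormNonneg (k - Complex.I) ∧ T†.FormNonneg (k - Complex.I) ∨
      T.FormNonneg (k + Complex.I) ∧ T†.FormNonneg (k + Complex.I)) : T.IsSectorial := by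
  refine isSectorial_iff.mpr ⟨hT.1, k, hk, ?_⟩
  rcases h with ⟨h1, h2⟩ | ⟨h1, h2⟩
  · have h3 := hT.adjoint.formNonneg_adjoint (by simpa using hk) h2
    rw [hT.adjoint_adjoint] at h3
    exact ⟨h1, by simpa using h3⟩
  · have h3 := hT.adjoint.formNonneg_adjoint (by simpa using hk) h2
    rw [hT.adjoint_adjoint] at h3
    exact ⟨by simpa [sub_eq_add_neg] using h3, h1⟩

theorem abs_re_inner_le_of_formNonneg_tildeOperator {A : H →ₗ.[ℂ] H} {B : H →L[ℂ] H}
    (hB : IsSelfAdjoint B) {k : ℝ}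
    (h : (A.tildeOperator B).FormNonneg (k - Complex.I) ∨
      (A.tildeOperator B).FormNonneg (k + Complex.I)) (u : A.domain) :
    |(inner ℂ (u : H) (B u)).re| ≤
      k * (inner ℂ (u : H) (A u)).re + |(inner ℂ (u : H) (A u)).im| := by
  have e1 : inner ℂ (blockVector u u : (A.tildeOperator B).domain).1
      (A.tildeOperator B (blockVector u u)) =
      2 * (inner ℂ (u : H) (A u) + Complex.I * inner ℂ (u : H) (B u)) := by
    refine (inner_blockVector _ _).trans ?_
    simp only [_root_.smul_apply, inner_add_right, inner_smul_right]
    ring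
  have e2 : inner ℂ (blockVector u (-u) : (A.tildeOperator B).domain).1
      (A.tildeOperator B (blockVector u (-u))) =
      2 * (inner ℂ (u : H) (A u) - Complex.I * inner ℂ (u : H) (B u)) := by
    refine (inner_blockVector _ _).trans ?_
    simp only [_root_.smul_apply, inner_add_right, inner_smul_right, LinearPMap.map_neg,
      Submodule.coe_neg, _root_.map_neg, inner_neg_left, inner_neg_right]
    ring
  -- Here `a = (Au,u)` and `b = (Bu,u)` is real: the values `a ± ib` have real part `Re a` and
  -- imaginary parts `Im a ± b`, so a bound from one side controls both signs of `b`.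
  have h1 : ∀ a b : ℂ, (0 ≤ (((k : ℂ) - Complex.I) * (2 * (a + Complex.I * b))).re ∧
      0 ≤ (((k : ℂ) - Complex.I) * (2 * (a - Complex.I * b))).re) ∨
      (0 ≤ (((k : ℂ) + Complex.I) * (2 * (a + Complex.I * b))).re ∧
      0 ≤ (((k : ℂ) + Complex.I) * (2 * (a - Complex.I * b))).re) → b.im = 0 →
      |b.re| ≤ k * a.re + |a.im| := by
    intro a b hab hb
    have h3 := neg_abs_le a.im
    have h4 := le_abs_self a.im
    simp only [Complex.ofReal_re, Complex.ofReal_im, Complex.mul_re, Complex.mul_im,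
      Complex.add_re, Complex.sub_re, Complex.add_im, Complex.sub_im, Complex.I_re,
      Complex.I_im, Complex.re_ofNat, Complex.im_ofNat, hb] at hab
    rw [abs_le]
    rcases hab with ⟨h1, h2⟩ | ⟨h1, h2⟩ <;> constructor <;> linarith
  refine h1 _ _ ?_ (im_inner_self_of_isSelfAdjoint hB u)
  rw [← e1, ← e2]
  exact h.imp (fun h => ⟨h _, h _⟩) fun h => ⟨h _, h _⟩

end LinearPMap

/-! ### The theorem -/

theorem proposition8p1 {H : Type*} [NormedAddCommGroup H] [InnerProductSpace ℂ H]
    [CompleteSpace H] (A : H →ₗ.[ℂ] H) (hA : A.IsMSectorial) (hA_unbounded : ¬ A.IsBoundedOperator)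
    (B : H →L[ℂ] H) (hB : IsSelfAdjoint B) :
    (A.addI B).domain ⊓ (A.addI B)†.domain = A.domain ⊓ A†.domain ∧
    (LinearMap.range A.toFun = ⊤ →
      LinearMap.ker A.toFun = ⊥ ∧ (A.addI B).IsMSectorial) ∧
    (LinearMap.ker A.toFun = ⊥ →
      ¬ BddAbove {t : ℝ | ∃ u : A.domain, u ≠ 0 ∧
        t = ‖inner ℂ (u : H) (B u)‖ / (inner ℂ (u : H) (A u)).re} →
      LinearMap.range A.toFun ≠ ⊤ ∧
      ((A.addI B).IsMAccretive ∧ ¬ (A.addI B).IsSectorial) ∧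
      ((A.addI B)†.IsMAccretive ∧ ¬ (A.addI B)†.IsSectorial) ∧
      (A.hatOperator B).IsMAccretive ∧
      (A.tildeOperator B).IsMAccretive ∧
      (A.hatOperator B).domain ⊓ (A.hatOperator B)†.domain =
        LinearPMap.directSum (A.domain ⊓ A†.domain) (A.domain ⊓ A†.domain) ∧
      (A.tildeOperator B).domain ⊓ (A.tildeOperator B)†.domain =
        LinearPMap.directSum (A.domain ⊓ A†.domain) (A.domain ⊓ A†.domain) ∧
      ∀ θ₁ θ₂ : ℝ, -(Real.pi / 2) ≤ θ₁ → θ₁ ≤ θ₂ → θ₂ ≤ Real.pi / 2 → θ₂ - θ₁ < Real.pi →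
        ¬ (A.hatOperator B).numericalRange ⊆ closedSector θ₁ θ₂ ∧
        ¬ (A.tildeOperator B).numericalRange ⊆ closedSector θ₁ θ₂) := by
  have hm := hA.2
  have hd := hm.2.1
  have hT := hm.addI hB
  have hTadj : (A.addI B)†.domain = A†.domain := by
    rw [LinearPMap.adjoint_addI hd hB, LinearPMap.addBounded_domain]
  have hTd : (A.addI B).domain = A.domain := rfl
  refine ⟨by rw [hTadj, hTd], fun hran => ⟨hA.ker_eq_bot hran, hA.addI hran hB⟩,
    fun _ hsup => ?_⟩
  have hns : ¬ (A.addI B).IsSectorial := fun h =>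
    hsup (LinearPMap.bddAbove_of_isSectorial_addI hA.1 hB h)
  have hhat := LinearPMap.hatOperator_eq hd hB
  refine ⟨fun hran => hns (hA.addI hran hB).1, ⟨hT, hns⟩,
    ⟨hT.adjoint, fun h => hns (hT.isSectorial_adjoint_iff.mp h)⟩, ?_, hm.tildeOperator hB,
    ?_, ?_, fun θ₁ θ₂ h₁ h₁₂ h₂ h => ⟨fun hW => ?_, fun hW => ?_⟩⟩
  · rw [hhat]
    exact hT.blockMatrix hT.adjoint
  · have h1 : (A.hatOperator B).domain = LinearPMap.directSum A.domain A†.domain := rfl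
    rw [h1, hhat, LinearPMap.adjoint_blockMatrix_domain hT.2.1 hT.adjoint.2.1,
      hT.adjoint_adjoint, hTadj, hTd, LinearPMap.directSum_inf_directSum, inf_comm A†.domain]
  · have h1 : (A.tildeOperator B).domain = LinearPMap.directSum A.domain A.domain := rfl
    rw [h1, LinearPMap.adjoint_tildeOperator_domain hd, LinearPMap.directSum_inf_directSum]
  · rw [hhat] at hW
    obtain ⟨k, hk, hform⟩ :=
      LinearPMap.exists_formNonneg_of_numericalRange_subset h₁ h₁₂ h₂ h hW
    exact hns (hT.isSectorial_of_formNonneg_adjoint hk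
      (hform.imp (fun h => h.of_blockMatrix) fun h => h.of_blockMatrix))
  · obtain ⟨k, hk, hform⟩ :=
      LinearPMap.exists_formNonneg_of_numericalRange_subset h₁ h₁₂ h₂ h hW
    obtain ⟨k', hk', him⟩ := hA.1.exists_abs_im_le
    refine hsup (LinearPMap.bddAbove_of_abs_re_inner_le hA.1.isAccretive hB (add_nonneg hk hk')
      fun u => ?_)
    have h1 := LinearPMap.abs_re_inner_le_of_formNonneg_tildeOperator hB hform u
    linarith [him u]
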